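/- Let $V$ be a finite nonempty set of nodes, let $m\ge 0$ and $n,d\ge 1$ be integers, and let $\mathcal G=(V,E)$ be a strongly connected labelled directed graph, possibly with parallel arcs, whose arc set is $E\subseteq V\times V\times\{1,\dots,m\}$; the triple $(u,v,\sigma)$ is an arc from $u$ to $v$ with label $\sigma$. Let $\mathcal A=(A_1,\dots,A_m)$ be real $n\times n$ matrices. The constrained joint spectral radius is $$\rho(\mathcal G,\mathcal A)=\lim_{k\to\infty}\max\|A_{\sigma_k}\cdots A_{\sigma_1}\|^{1/k},$$ where the maximum is over the words $(\sigma_1,\dots,\sigma_k)$ that are the labels of a path of length $k$ in $\mathcal G$ (a maximum over the empty set is $0$). For a graph $\mathcal H=(V,F)$ with $F\subseteq E$, $A(\mathcal H)$ is the $V\times V$ matrix whose $(u,v)$ entry is the number of arcs from $u$ to $v$ in $F$, and $\rho(A(\mathcal H))$ is its spectral radius. Let $\mathbb R_{2d}[x]$ be the space of homogeneous real polynomials of degree $2d$ in $n$ variables, and let $\Sigma_{2d}$ be the cone of sums of squares in it, with dual cone $\Sigma_{2d}^*=\{\mu\in\mathbb R_{2d}[x]^*:\langle\mu,p\rangle\ge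 0\ \ \forall p\in\Sigma_{2d}\}$. Primal program: $\rho_{\mathrm{SOS},2d}$ is the infimum of the $\gamma\ge 0$ for which there are strictly positive $p_v\in\Sigma_{2d}$ $(v\in V)$ with $\sum_{v}\int_{\mathbb S^{n-1}}p_v(x)\,dx=1$ and $\gamma^{2d}p_u(x)-p_v(A_\sigma x)\in\Sigma_{2d}$ for all $(u,v,\sigma)\in E$. Dual program: $((\mu_e)_{e\in E},\gamma)$ is a dual solution if $\gamma\ge 0$, $\mu_e\in\Sigma_{2d}^*$ for all $e\in E$, $\sum_{e\in E}\langle\mu_e,\|x\|_2^{2d}\rangle=1$, and for every $v\in V$ and $p\in\Sigma_{2d}$ $$\sum_{(u,v,\sigma)\in E}\langle\mu_{uv\sigma},p(A_\sigma x)\rangle\ \ge\ \gamma^{2d}\sum_{(v,w,\sigma)\in E}\langle\mu_{vw\sigma},p\rangle .$$ Theorem. (1) Let $Z\subseteq E$ be a set of arcs whose dual variables can simultaneously be taken as zero in near-optimal dual solutions; that is, there is a $\delta>0$ such that for all $0<\varepsilon<\delta$ there is a dual solution with $\gamma\ge\rho_{\mathrm{SOS},2d}-\varepsilon$ and $\mu_e=0$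 for all $e\in Z$. Let $\mathcal G_{2d}=(V,E\setminus Z)$ be the subgraph of the remaining arcs. Then $$\rho_{\mathrm{SOS},2d}\ \le\ \rho(A(\mathcal G_{2d}))^{\frac1{2d}}\,\rho(\mathcal G,\mathcal A).$$ (2) The same inequality holds, without any hypothesis on the dual program, when $\mathcal G_{2d}=(V,E_{2d})$, where $E_{2d}$ is the set of the arcs $e\in E$ for which there is a $\delta>0$ such that for all $0<\varepsilon<\delta$ there is a dual solution with $\gamma\ge\rho_{\mathrm{SOS},2d}-\varepsilon$ and $\mu_e\ne 0$. -/

import Mathlib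

open Filter MeasureTheory Topology

noncomputable section

/-- An automaton: a labelled directed graph with node set `V`, possibly with parallel arcs.
The triple `(u, v, σ)` is the arc from `u` to `v` with label `σ`. -/
structure Automaton (V : Type*) (m : ℕ) where
  arcs : Finset (V × V × Fin m)

namespace Automaton

variable {V : Type*} {m : ℕ}

/-- There is an arc, with any label, from `u` to `v`. -/
def Step (G : Automaton V m) (u v : V) : Prop :=
  ∃ σ : Fin m, (u, v, σ) ∈ G.arcs

/-- Every node can be reached from every node along a directed path. -/
def StronglyConnected (G : Automaton V m) : Prop :=
  ∀ u v : V, Relation.ReflTransGen G.Step u v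

/-- The word `σ` of length `k` consists of the labels of a path of length `k`. -/
def Admissible (G : Automaton V m) {k : ℕ} (σ : Fin k → Fin m) : Prop :=
  ∃ w : Fin (k + 1) → V, ∀ i : Fin k, (w i.castSucc, w i.succ, σ i) ∈ G.arcs

/-- The automaton on the same nodes whose arcs are the arcs of `G` outside `Z`. -/
def deleteArcs [DecidableEq V] (G : Automaton V m) (Z : Finset (V × V × Fin m)) :
    Automaton V m :=
  ⟨G.arcs \ Z⟩

/-- The adjacency matrix: the `(u, v)` entry is the number of arcs from `u` to `v`. -/
def adjMatrix [DecidableEq V] (G : Automaton V m) : Matrix V V ℕ :=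
  fun u v => (G.arcs.filter fun e => e.1 = u ∧ e.2.1 = v).card

/-- The spectral radius `ρ(A(G))`: the largest modulus of a complex eigenvalue of the
adjacency matrix. -/
def adjSpectralRadius [Fintype V] [DecidableEq V] (G : Automaton V m) : ℝ :=
  (spectralRadius ℂ (G.adjMatrix.map (Nat.cast : ℕ → ℂ))).toReal

end Automaton

section JointSpectralRadius

variable {V : Type*} {m n : ℕ}

/-- The product `A_{σ_k} ⋯ A_{σ_1}` along the word `σ = (σ_1, …, σ_k)`. -/
def wordProduct (A : Fin m → Matrix (Fin n) (Fin n) ℝ) {k : ℕ} (σ : Fin k → Fin m) :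
    Matrix (Fin n) (Fin n) ℝ :=
  (List.ofFn fun i => A (σ i)).reverse.prod

/-- The largest value of `‖A_s‖₂ ^ (1 / k)` over the admissible words `s` of length `k`
(and `0` if there is no such word). -/
def cjsrAt (G : Automaton V m) (A : Fin m → Matrix (Fin n) (Fin n) ℝ) (k : ℕ) : ℝ :=
  sSup {r : ℝ | ∃ σ : Fin k → Fin m, G.Admissible σ ∧
    r = ‖Matrix.toEuclideanCLM (𝕜 := ℝ) (wordProduct A σ)‖ ^ (1 / (k : ℝ))}

/-- The constrained joint spectral radius. The sequence `cjsrAt G A` is bounded and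
converges, so that this upper limit is its limit. -/
def cjsr (G : Automaton V m) (A : Fin m → Matrix (Fin n) (Fin n) ℝ) : ℝ :=
  limsup (cjsrAt G A) atTop

end JointSpectralRadius

section Forms

variable {n : ℕ}

/-- The real vector space of homogeneous polynomials of degree `k` in `n` variables. -/
abbrev Form (n k : ℕ) : Type :=
  MvPolynomial.homogeneousSubmodule (Fin n) ℝ k

/-- The linear forms given by the rows of `A`. -/
def rowForm (A : Matrix (Fin n) (Fin n) ℝ) (i : Fin n) : MvPolynomial (Fin n) ℝ :=
  ∑ j, MvPolynomial.C (A i j) * MvPolynomial.X j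

theorem rowForm_isHomogeneous (A : Matrix (Fin n) (Fin n) ℝ) (i : Fin n) :
    (rowForm A i).IsHomogeneous 1 := by
  refine MvPolynomial.IsHomogeneous.sum _ _ _ fun j _ => ?_
  simpa using (MvPolynomial.isHomogeneous_C (Fin n) (A i j)).mul
    (MvPolynomial.isHomogeneous_X ℝ j)

/-- The linear map `p(x) ↦ p(A x)` on the homogeneous polynomials of degree `k`. -/
def Form.comp {k : ℕ} (A : Matrix (Fin n) (Fin n) ℝ) : Form n k →ₗ[ℝ] Form n k :=
  (MvPolynomial.aeval (rowForm A)).toLinearMap.restrict fun p hp => by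
    have h := MvPolynomial.IsHomogeneous.aeval
      ((MvPolynomial.mem_homogeneousSubmodule k p).1 hp) (rowForm A) (rowForm_isHomogeneous A)
    rw [one_mul] at h
    exact (MvPolynomial.mem_homogeneousSubmodule k _).2 h

/-- The form is a sum of squares of polynomials. -/
def Form.IsSOS {k : ℕ} (p : Form n k) : Prop :=
  IsSumSq (p : MvPolynomial (Fin n) ℝ)

/-- The value of the form at a point. -/
def Form.eval {k : ℕ} (p : Form n k) (x : EuclideanSpace ℝ (Fin n)) : ℝ :=
  MvPolynomial.eval (fun i => x i) (p : MvPolynomial (Fin n) ℝ)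

/-- The form is positive at every nonzero point. -/
def Form.StrictlyPositive {k : ℕ} (p : Form n k) : Prop :=
  ∀ x : EuclideanSpace ℝ (Fin n), x ≠ 0 → 0 < p.eval x

/-- The integral of the form over the Euclidean unit sphere, for the surface measure. -/
def Form.sphereIntegral {k : ℕ} (p : Form n k) : ℝ :=
  ∫ x : Metric.sphere (0 : EuclideanSpace ℝ (Fin n)) 1, p.eval x
    ∂((volume : Measure (EuclideanSpace ℝ (Fin n))).toSphere)

/-- The form `‖x‖₂ ^ (2 d) = (x_1 ^ 2 + ⋯ + x_n ^ 2) ^ d`. -/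
def normForm (n d : ℕ) : Form n (2 * d) :=
  ⟨(∑ i, MvPolynomial.X i ^ 2) ^ d, (MvPolynomial.mem_homogeneousSubmodule _ _).2
    ((MvPolynomial.IsHomogeneous.sum _ _ 2 fun i _ =>
      MvPolynomial.isHomogeneous_X_pow i 2).pow d)⟩

/-- Linear functionals on the homogeneous polynomials of degree `k`. -/
abbrev FormDual (n k : ℕ) : Type := Module.Dual ℝ (Form n k)

/-- Membership in the dual of the cone of sums of squares: the functional is a
pseudo-measure. -/
def FormDual.IsPseudoMeasure {k : ℕ} (μ : FormDual n k) : Prop :=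
  ∀ p : Form n k, p.IsSOS → 0 ≤ μ p

/-- The push-forward of a functional under `x ↦ A x`: it sends `p(x)` to `μ(p(A x))`. -/
def FormDual.push {k : ℕ} (A : Matrix (Fin n) (Fin n) ℝ) (μ : FormDual n k) : FormDual n k :=
  μ.comp (Form.comp A)

end Forms

section Programs

variable {V : Type*} {m n : ℕ}

/-- `(p, γ)` is a feasible solution of the primal sum of squares program. -/
structure PrimalFeasible [Fintype V] (G : Automaton V m)
    (A : Fin m → Matrix (Fin n) (Fin n) ℝ) (d : ℕ) (p : V → Form n (2 * d)) (γ : ℝ) : Prop where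
  nonneg : 0 ≤ γ
  decrease : ∀ e ∈ G.arcs, (γ ^ (2 * d) • p e.1 - Form.comp (A e.2.2) (p e.2.1)).IsSOS
  sos : ∀ v, (p v).IsSOS
  pos : ∀ v, (p v).StrictlyPositive
  normalized : ∑ v, (p v).sphereIntegral = 1

/-- The approximation `ρ_{SOS,2d}` of the constrained joint spectral radius: the optimal
value of the primal program. -/
def rhoSOS [Fintype V] (G : Automaton V m) (A : Fin m → Matrix (Fin n) (Fin n) ℝ) (d : ℕ) : ℝ :=
  sInf {γ : ℝ | ∃ p : V → Form n (2 * d), PrimalFeasible G A d p γ}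

/-- `(μ, γ)` is a feasible solution of the dual sum of squares program. Only the values of
`μ` at arcs of `G` matter. -/
structure DualFeasible [DecidableEq V] (G : Automaton V m)
    (A : Fin m → Matrix (Fin n) (Fin n) ℝ) (d : ℕ)
    (μ : V × V × Fin m → FormDual n (2 * d)) (γ : ℝ) : Prop where
  nonneg : 0 ≤ γ
  growth : ∀ v : V,
    (∑ e ∈ G.arcs.filter (fun e => e.2.1 = v), (μ e).push (A e.2.2)
      - γ ^ (2 * d) • ∑ e ∈ G.arcs.filter (fun e => e.1 = v), μ e).IsPseudoMeasure
  pseudo : ∀ e ∈ G.arcs, (μ e).IsPseudoMeasure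
  normalized : ∑ e ∈ G.arcs, μ e (normForm n d) = 1

/-- The dual variables of all the arcs in `Z` can simultaneously be taken to be zero in
dual solutions that are arbitrarily close to optimal. -/
def JointlyZeroable [Fintype V] [DecidableEq V] (G : Automaton V m)
    (A : Fin m → Matrix (Fin n) (Fin n) ℝ) (d : ℕ) (Z : Finset (V × V × Fin m)) : Prop :=
  ∃ δ > 0, ∀ ε : ℝ, 0 < ε → ε < δ →
    ∃ (μ : V × V × Fin m → FormDual n (2 * d)) (γ : ℝ),
      DualFeasible G A d μ γ ∧ rhoSOS G A d - ε ≤ γ ∧ ∀ e ∈ Z, μ e = 0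

open Classical in
/-- The subgraph of the arcs whose dual variable is nonzero in some dual solutions that
are arbitrarily close to optimal. -/
def dualSupport [Fintype V] [DecidableEq V] (G : Automaton V m)
    (A : Fin m → Matrix (Fin n) (Fin n) ℝ) (d : ℕ) : Automaton V m :=
  ⟨G.arcs.filter fun e => ∃ δ > 0, ∀ ε : ℝ, 0 < ε → ε < δ →
    ∃ (μ : V × V × Fin m → FormDual n (2 * d)) (γ : ℝ),
      DualFeasible G A d μ γ ∧ rhoSOS G A d - ε ≤ γ ∧ μ e ≠ 0⟩

end Programs

end

/-! Write `N` for the form `‖x‖ ^ (2d)`. Given a dual solution vanishing on `Z`, let `ν v` be the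
sum of the `μ e` over the arcs leaving `v`. Each `μ e` is at most `ν` at its source on sums of
squares, so `γ ^ (2d) * ν v p` is at most the sum of `ν u (p(A_σ x))` over the arcs `(u, v, σ)`
outside `Z`. Iterating `k` times from `p = N` gives a sum over paths of length `k`
(`pow_mul_apply_comp_normForm_le`). If every product `P` along these paths has norm at most `C`,
then `C ^ (2d) N - N(P x)` is a sum of squares, not merely nonnegative, so pseudo-measures respect
the bound. As the values `ν v N` sum to one, `γ ^ (2dk)` is at most `C ^ (2d)` times the number of
paths. Taking `k`th roots, Gelfand's formula yields `γ ^ (2d) ≤ ρ(A(H)) * ρ ^ (2d)`, where `H` is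
the graph without `Z`; part (1) follows as `ε → 0`.

For part (2), an arc outside the dual support has zero variable in every sufficiently near-optimal
dual solution. There are finitely many arcs, so one threshold serves them all, and part (1) applies
once near-optimal dual solutions exist. Existence is strong duality
(`exists_dualFeasible_of_lt_rhoSOS`), from the M. Riesz extension theorem with `N` as order unit. -/

/-! ### Comparisons modulo sums of squares -/

section SumsOfSquares

variable {n : ℕ}

theorem IsSumSq.smul_mvPolynomial {σ : Type*} {p : MvPolynomial σ ℝ} (hp : IsSumSq p) {c : ℝ}
    (hc : 0 ≤ c) : IsSumSq (c • p) := by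
  have h : IsSumSq (MvPolynomial.C c : MvPolynomial σ ℝ) := by
    rw [← Real.mul_self_sqrt hc, map_mul]
    exact IsSumSq.mul_self _
  rw [MvPolynomial.smul_eq_C_mul]
  exact h.mul hp

theorem IsSumSq.pow {R : Type*} [CommSemiring R] {a : R} (ha : IsSumSq a) (k : ℕ) :
    IsSumSq (a ^ k) := by
  induction k with
  | zero => simp
  | succ k ih => rw [pow_succ]; exact ih.mul ha

/-- The powers of sums of squares are monotone for the order defined by sums of squares. -/
theorem IsSumSq.pow_sub_pow {R : Type*} [CommRing R] {a b : R} (ha : IsSumSq a) (hb : IsSumSq b)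
    (hab : IsSumSq (a - b)) (k : ℕ) : IsSumSq (a ^ k - b ^ k) := by
  induction k with
  | zero => simp
  | succ k ih =>
    have h : a ^ (k + 1) - b ^ (k + 1) = a * (a ^ k - b ^ k) + (a - b) * b ^ k := by ring
    rw [h]
    exact (ha.mul ih).add (hab.mul (hb.pow k))

/-- The square `‖x‖²` of the Euclidean norm as a polynomial. -/
noncomputable def normSqPoly (n : ℕ) : MvPolynomial (Fin n) ℝ := ∑ i, MvPolynomial.X i ^ 2

theorem isSumSq_normSqPoly : IsSumSq (normSqPoly n) := IsSumSq.sum_sq _ _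

theorem isSumSq_normSqPoly_sub_X_sq (i : Fin n) :
    IsSumSq (normSqPoly n - MvPolynomial.X i ^ 2) := by
  rw [normSqPoly, ← Finset.add_sum_erase _ _ (Finset.mem_univ i), add_sub_cancel_left]
  exact IsSumSq.sum_sq _ _

/-- The inequality `(a + b)² ≤ 2a² + 2b²`, whose defect is the square `(a - b)²`. -/
theorem exists_smul_sub_sq_add_sq {R : Type*} [CommRing R] [Algebra ℝ R] {r a b : R} {s t : ℝ}
    (ha : IsSumSq (s • r - a ^ 2)) (hb : IsSumSq (t • r - b ^ 2)) :
    IsSumSq ((2 * (s + t)) • r - (a + b) ^ 2) := by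
  have h : (2 * (s + t)) • r - (a + b) ^ 2 = ((s • r - a ^ 2) + (s • r - a ^ 2)) +
      ((t • r - b ^ 2) + (t • r - b ^ 2)) + (a - b) * (a - b) := by
    rw [mul_smul, two_smul, add_smul]
    ring
  rw [h]
  exact ((ha.add ha).add (hb.add hb)).add (IsSumSq.mul_self _)

/-- The square of a linear form is dominated by a multiple of `‖x‖²`. -/
theorem exists_isSumSq_smul_normSqPoly_sub_sq {q : MvPolynomial (Fin n) ℝ}
    (hq : q ∈ MvPolynomial.homogeneousSubmodule (Fin n) ℝ 1) :
    ∃ t : ℝ, 0 ≤ t ∧ IsSumSq (t • normSqPoly n - q ^ 2) := by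
  rw [MvPolynomial.homogeneousSubmodule_one_eq_span_X] at hq
  induction hq using Submodule.span_induction with
  | mem x hx =>
    obtain ⟨i, rfl⟩ := hx
    exact ⟨1, zero_le_one, by rw [one_smul]; exact isSumSq_normSqPoly_sub_X_sq i⟩
  | zero => exact ⟨0, le_rfl, by simp⟩
  | add x y _ _ hx hy =>
    obtain ⟨s, hs, hx⟩ := hx
    obtain ⟨t, ht, hy⟩ := hy
    exact ⟨2 * (s + t), by positivity, exists_smul_sub_sq_add_sq hx hy⟩
  | smul c x _ hx =>
    obtain ⟨s, hs, hx⟩ := hx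
    refine ⟨c ^ 2 * s, by positivity, ?_⟩
    rw [smul_pow, mul_smul, ← smul_sub]
    exact hx.smul_mvPolynomial (sq_nonneg c)

/-- The square of a form of degree `k` is dominated by a multiple of `‖x‖ ^ (2 k)`. -/
theorem exists_isSumSq_smul_normSqPoly_pow_sub_sq {k : ℕ} {q : MvPolynomial (Fin n) ℝ}
    (hq : q ∈ MvPolynomial.homogeneousSubmodule (Fin n) ℝ k) :
    ∃ t : ℝ, 0 ≤ t ∧ IsSumSq (t • normSqPoly n ^ k - q ^ 2) := by
  -- Forms of degree `k` are spanned by products of `k` linear forms, which allows induction on the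
  -- factors.
  rw [← MvPolynomial.homogeneousSubmodule_one_pow] at hq
  induction hq using Submodule.pow_induction_on_left' with
  | algebraMap c =>
    refine ⟨c ^ 2, sq_nonneg c, ?_⟩
    rw [pow_zero, ← Algebra.algebraMap_eq_smul_one, map_pow, sub_self]
    exact IsSumSq.zero
  | add x y i _ _ hx hy =>
    obtain ⟨s, hs, hx⟩ := hx
    obtain ⟨t, ht, hy⟩ := hy
    exact ⟨2 * (s + t), by positivity, exists_smul_sub_sq_add_sq hx hy⟩
  | mem_mul m hm i x _ hx =>
    obtain ⟨s, hs, hm⟩ := exists_isSumSq_smul_normSqPoly_sub_sq hm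
    obtain ⟨t, ht, hx⟩ := hx
    refine ⟨s * t, mul_nonneg hs ht, ?_⟩
    have h : (s * t) • normSqPoly n ^ (i + 1) - (m * x) ^ 2 =
        s • normSqPoly n * (t • normSqPoly n ^ i - x ^ 2) +
          (s • normSqPoly n - m ^ 2) * (x * x) := by
      simp only [MvPolynomial.smul_eq_C_mul, map_mul]
      ring
    rw [h]
    exact ((isSumSq_normSqPoly.smul_mvPolynomial hs).mul hx).add (hm.mul (IsSumSq.mul_self x))

/-- The form `‖x‖ ^ (2 d)` is in the interior of the cone of sums of squares. -/
theorem exists_isSumSq_smul_normSqPoly_pow_add {d : ℕ} {p : MvPolynomial (Fin n) ℝ}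
    (hp : p ∈ MvPolynomial.homogeneousSubmodule (Fin n) ℝ (2 * d)) :
    ∃ t : ℝ, 0 ≤ t ∧ IsSumSq (t • normSqPoly n ^ d + p) := by
  rw [← MvPolynomial.homogeneousSubmodule_one_pow, two_mul, pow_add,
    MvPolynomial.homogeneousSubmodule_one_pow] at hp
  induction hp using Submodule.mul_induction_on' with
  | mem_mul_mem a ha b hb =>
    obtain ⟨s, hs, ha⟩ := exists_isSumSq_smul_normSqPoly_pow_sub_sq ha
    obtain ⟨t, ht, hb⟩ := exists_isSumSq_smul_normSqPoly_pow_sub_sq hb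
    -- Polarization: `ab = ½((a + b)² - a² - b²)`, and the two negative squares are absorbed by
    -- multiples of `‖x‖ ^ (2d)`.
    refine ⟨(1 / 2) * (s + t), by positivity, ?_⟩
    have h : ((1 / 2) * (s + t)) • normSqPoly n ^ d + a * b = (1 / 2 : ℝ) •
        ((s • normSqPoly n ^ d - a ^ 2) + (t • normSqPoly n ^ d - b ^ 2) + (a + b) * (a + b)) := by
      have h2 : MvPolynomial.C (1 / 2 : ℝ) * (2 : MvPolynomial (Fin n) ℝ) = 1 := by
        rw [← map_ofNat MvPolynomial.C 2, ← map_mul]; norm_num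
      simp only [MvPolynomial.smul_eq_C_mul, map_mul, map_add]
      linear_combination (-(a * b)) * h2
    rw [h]
    exact ((ha.add hb).add (IsSumSq.mul_self _)).smul_mvPolynomial (by norm_num)
  | add x _ y _ hx hy =>
    obtain ⟨s, hs, hx⟩ := hx
    obtain ⟨t, ht, hy⟩ := hy
    refine ⟨s + t, by positivity, ?_⟩
    rw [add_smul, add_add_add_comm]
    exact hx.add hy

/-- `‖B x‖²` depends on `B` only through its Gram matrix, so equal Gram matrices give equal forms.
-/
theorem sum_rowForm_sq (B : Matrix (Fin n) (Fin n) ℝ) :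
    ∑ i, rowForm B i ^ 2 =
      ∑ j, ∑ k, MvPolynomial.C ((B.transpose * B) j k) * (MvPolynomial.X j * MvPolynomial.X k) := by
  simp only [rowForm, sq, Finset.sum_mul_sum]
  simp only [Matrix.mul_apply, Matrix.transpose_apply, map_sum, Finset.sum_mul]
  rw [Finset.sum_comm]
  refine Finset.sum_congr rfl fun j _ => ?_
  rw [Finset.sum_comm]
  refine Finset.sum_congr rfl fun k _ => Finset.sum_congr rfl fun i _ => ?_
  rw [map_mul]
  ring

open Matrix MatrixOrder in
/-- The quadratic form `C² ‖x‖² - ‖A x‖²` is a sum of squares when `‖A‖ ≤ C`. -/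
theorem isSumSq_smul_normSqPoly_sub_rowForm_sq {A : Matrix (Fin n) (Fin n) ℝ} {C : ℝ}
    (hA : ‖toEuclideanCLM (𝕜 := ℝ) A‖ ≤ C) :
    IsSumSq (C ^ 2 • normSqPoly n - ∑ i, rowForm A i ^ 2) := by
  have hC : 0 ≤ C := (norm_nonneg _).trans hA
  have hpsd : (C ^ 2 • (1 : Matrix (Fin n) (Fin n) ℝ) - Aᵀ * A).PosSemidef := by
    refine PosSemidef.of_dotProduct_mulVec_nonneg ?_ fun x => ?_
    · simp [IsHermitian, conjTranspose_eq_transpose_of_trivial]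
    · have h := (toEuclideanCLM (𝕜 := ℝ) A).le_of_opNorm_le hA (WithLp.toLp 2 x)
      have h2 := pow_le_pow_left₀ (norm_nonneg _) h 2
      rw [mul_pow, EuclideanSpace.norm_sq_eq, EuclideanSpace.norm_sq_eq] at h2
      simp only [toEuclideanCLM_toLp, Real.norm_eq_abs, sq_abs] at h2
      have h3 : star x ⬝ᵥ ((C ^ 2 • (1 : Matrix (Fin n) (Fin n) ℝ) - Aᵀ * A) *ᵥ x) =
          C ^ 2 * ∑ i, x i ^ 2 - ∑ i, (A *ᵥ x) i ^ 2 := by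
        rw [sub_mulVec, dotProduct_sub, smul_mulVec, one_mulVec, dotProduct_smul,
          ← mulVec_mulVec, dotProduct_mulVec, star_trivial, vecMul_transpose]
        simp [dotProduct, sq]
      rw [h3]
      exact sub_nonneg.2 h2
  -- Factoring `C² I - AᵀA = BᵀB` exhibits the squares: they are those of the row forms of `B`.
  obtain ⟨B, hB⟩ := CStarAlgebra.nonneg_iff_eq_star_mul_self.mp hpsd.nonneg
  rw [star_eq_conjTranspose, conjTranspose_eq_transpose_of_trivial] at hB
  have h : C ^ 2 • normSqPoly n - ∑ i, rowForm A i ^ 2 = ∑ i, rowForm B i ^ 2 := by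
    rw [sum_rowForm_sq B, ← hB, sum_rowForm_sq A]
    simp only [Matrix.sub_apply, Matrix.smul_apply, one_apply, map_sub, sub_mul, Finset.sum_sub_distrib]
    congr 1
    simp [normSqPoly, Finset.smul_sum, MvPolynomial.smul_eq_C_mul, sq,
      apply_ite (MvPolynomial.C : ℝ → MvPolynomial (Fin n) ℝ)]
  rw [h]
  exact IsSumSq.sum_sq _ _

end SumsOfSquares

/-! ### The cone of sums of squares under linear substitution -/

section FormCone

variable {n k : ℕ}

namespace Form

theorem IsSOS.zero : (0 : Form n k).IsSOS := IsSumSq.zero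

theorem IsSOS.add {p q : Form n k} (hp : p.IsSOS) (hq : q.IsSOS) : (p + q).IsSOS :=
  IsSumSq.add hp hq

theorem IsSOS.smul {p : Form n k} (hp : p.IsSOS) {c : ℝ} (hc : 0 ≤ c) : (c • p).IsSOS :=
  IsSumSq.smul_mvPolynomial hp hc

theorem coe_comp (A : Matrix (Fin n) (Fin n) ℝ) (p : Form n k) :
    (Form.comp A p : MvPolynomial (Fin n) ℝ) = 
      MvPolynomial.aeval (rowForm A) (p : MvPolynomial (Fin n) ℝ) := rfl

theorem IsSOS.comp {p : Form n k} (hp : p.IsSOS) (A : Matrix (Fin n) (Fin n) ℝ) :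
    (Form.comp A p).IsSOS := by
  have h : ∀ q : MvPolynomial (Fin n) ℝ, IsSumSq q →
      IsSumSq (MvPolynomial.aeval (rowForm A) q) := by
    intro q hq
    induction hq with
    | zero => simp
    | sq_add a _ ih => rw [map_add, map_mul]; exact IsSumSq.sq_add _ ih
  exact h _ hp

theorem comp_comp (A B : Matrix (Fin n) (Fin n) ℝ) (p : Form n k) :
    Form.comp B (Form.comp A p) = Form.comp (A * B) p := by
  apply Subtype.ext
  rw [coe_comp, coe_comp, coe_comp]
  have h : (MvPolynomial.aeval (rowForm B)).comp (MvPolynomial.aeval (rowForm A)) =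
      (MvPolynomial.aeval (rowForm (A * B)) :
        MvPolynomial (Fin n) ℝ →ₐ[ℝ] MvPolynomial (Fin n) ℝ) := by
    apply MvPolynomial.algHom_ext
    intro i
    simp only [AlgHom.comp_apply, MvPolynomial.aeval_X, rowForm, map_sum, map_mul,
      MvPolynomial.algHom_C, Matrix.mul_apply, Finset.mul_sum, Finset.sum_mul,
      MvPolynomial.algebraMap_eq]
    rw [Finset.sum_comm]
    simp only [mul_assoc]
  exact DFunLike.congr_fun h _

theorem isSOS_normForm (n d : ℕ) : (normForm n d).IsSOS :=
  isSumSq_normSqPoly.pow d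

/-- The quadratic comparison raised to the power `d`. It turns an operator norm bound into an
inequality that pseudo-measures respect. -/
theorem isSOS_smul_normForm_sub_comp {A : Matrix (Fin n) (Fin n) ℝ} {C : ℝ}
    (hA : ‖Matrix.toEuclideanCLM (𝕜 := ℝ) A‖ ≤ C) (d : ℕ) :
    (C ^ (2 * d) • normForm n d - Form.comp A (normForm n d)).IsSOS := by
  have h := IsSumSq.pow_sub_pow (isSumSq_normSqPoly.smul_mvPolynomial (sq_nonneg C))
    (IsSumSq.sum_sq _ _) (isSumSq_smul_normSqPoly_sub_rowForm_sq hA) d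
  rw [smul_pow, ← pow_mul] at h
  have h2 : (Form.comp A (normForm n d) : MvPolynomial (Fin n) ℝ) =
      (∑ i, rowForm A i ^ 2) ^ d := by
    rw [coe_comp]
    simp [normForm]
  rw [IsSOS, AddSubgroupClass.coe_sub, h2]
  exact h

theorem exists_isSOS_smul_normForm_add {d : ℕ} (p : Form n (2 * d)) :
    ∃ t : ℝ, 0 ≤ t ∧ (t • normForm n d + p).IsSOS :=
  exists_isSumSq_smul_normSqPoly_pow_add p.2

end Form

end FormCone

/-! ### Products along paths and the constrained joint spectral radius -/

section Words

variable {V : Type*} {m n : ℕ}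

/-- The word `σ` consists of the labels of a path that ends at `v`. -/
def Automaton.AdmissibleTo (G : Automaton V m) (v : V) {k : ℕ} (σ : Fin k → Fin m) : Prop :=
  ∃ w : Fin (k + 1) → V, w (Fin.last k) = v ∧ ∀ i : Fin k, (w i.castSucc, w i.succ, σ i) ∈ G.arcs

theorem Automaton.AdmissibleTo.admissible {G H : Automaton V m} (h : H.arcs ⊆ G.arcs) {v : V}
    {k : ℕ} {σ : Fin k → Fin m} (hσ : H.AdmissibleTo v σ) : G.Admissible σ := by
  obtain ⟨w, -, hw⟩ := hσ
  exact ⟨w, fun i => h (hw i)⟩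

theorem Automaton.AdmissibleTo.snoc {G : Automaton V m} {u v : V} {s : Fin m}
    (he : (u, v, s) ∈ G.arcs) {k : ℕ} {σ : Fin k → Fin m} (hσ : G.AdmissibleTo u σ) :
    G.AdmissibleTo v (Fin.snoc σ s : Fin (k + 1) → Fin m) := by
  obtain ⟨w, hu, hw⟩ := hσ
  refine ⟨(Fin.snoc w v : Fin (k + 1 + 1) → V), by simp, fun i => ?_⟩
  induction i using Fin.lastCases with
  | last => simpa [hu] using he
  | cast i =>
    simp only [Fin.succ_castSucc, Fin.snoc_castSucc]
    exact hw i

theorem wordProduct_snoc (A : Fin m → Matrix (Fin n) (Fin n) ℝ) {k : ℕ} (σ : Fin k → Fin m)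
    (s : Fin m) :
    wordProduct A (Fin.snoc σ s : Fin (k + 1) → Fin m) = A s * wordProduct A σ := by
  simp only [wordProduct, List.ofFn_succ', Fin.snoc_castSucc, Fin.snoc_last, List.concat_eq_append,
    List.reverse_append, List.reverse_singleton, List.singleton_append, List.prod_cons]

theorem exists_norm_wordProduct_le (A : Fin m → Matrix (Fin n) (Fin n) ℝ) :
    ∃ K : ℝ, 0 ≤ K ∧ ∀ (k : ℕ) (σ : Fin k → Fin m),
      ‖Matrix.toEuclideanCLM (𝕜 := ℝ) (wordProduct A σ)‖ ≤ K ^ k := by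
  have hK : 0 ≤ ∑ s, ‖Matrix.toEuclideanCLM (𝕜 := ℝ) (A s)‖ :=
    Finset.sum_nonneg fun _ _ => norm_nonneg _
  refine ⟨_, hK, fun k => ?_⟩
  induction k with
  | zero =>
    intro σ
    rw [wordProduct, List.ofFn_zero, List.reverse_nil, List.prod_nil, map_one, pow_zero]
    exact ContinuousLinearMap.norm_id_le
  | succ k ih =>
    intro σ
    rw [← Fin.snoc_init_self σ, wordProduct_snoc, map_mul, pow_succ']
    refine (norm_mul_le _ _).trans (mul_le_mul ?_ (ih _) (norm_nonneg _) hK)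
    exact Finset.single_le_sum (f := fun s => ‖Matrix.toEuclideanCLM (𝕜 := ℝ) (A s)‖)
      (fun _ _ => norm_nonneg _) (Finset.mem_univ _)

theorem cjsrAt_nonneg (G : Automaton V m) (A : Fin m → Matrix (Fin n) (Fin n) ℝ) (k : ℕ) :
    0 ≤ cjsrAt G A k := by
  refine Real.sSup_nonneg ?_
  rintro _ ⟨σ, -, rfl⟩
  positivity

/-- Boundedness makes the real `limsup` meaningful. Length `0` is excluded because the exponent `1 /
0` is `0`, so the root no longer undoes the power. -/
theorem exists_cjsrAt_le (G : Automaton V m) (A : Fin m → Matrix (Fin n) (Fin n) ℝ) :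
    ∃ K : ℝ, ∀ k, k ≠ 0 → cjsrAt G A k ≤ K := by
  obtain ⟨K, hK, h⟩ := exists_norm_wordProduct_le A
  refine ⟨K, fun k hk => Real.sSup_le ?_ hK⟩
  rintro _ ⟨σ, -, rfl⟩
  rw [one_div]
  refine (Real.rpow_le_rpow (norm_nonneg _) (h k σ) (by positivity)).trans_eq ?_
  exact Real.pow_rpow_inv_natCast hK hk

theorem norm_wordProduct_le_cjsrAt_pow {G : Automaton V m} (A : Fin m → Matrix (Fin n) (Fin n) ℝ)
    {k : ℕ} (hk : k ≠ 0) {σ : Fin k → Fin m} (hσ : G.Admissible σ) :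
    ‖Matrix.toEuclideanCLM (𝕜 := ℝ) (wordProduct A σ)‖ ≤ cjsrAt G A k ^ k := by
  -- There are finitely many words, so the real supremum is a genuine upper bound and not a default
  -- value.
  have hfin : {r : ℝ | ∃ σ : Fin k → Fin m, G.Admissible σ ∧
      r = ‖Matrix.toEuclideanCLM (𝕜 := ℝ) (wordProduct A σ)‖ ^ (1 / (k : ℝ))}.Finite := by
    refine (Set.finite_range fun σ : Fin k → Fin m =>
      ‖Matrix.toEuclideanCLM (𝕜 := ℝ) (wordProduct A σ)‖ ^ (1 / (k : ℝ))).subset ?_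
    rintro _ ⟨σ, -, rfl⟩
    exact ⟨σ, rfl⟩
  have h := pow_le_pow_left₀ (by positivity) (le_csSup hfin.bddAbove ⟨σ, hσ, rfl⟩) k
  refine le_trans (le_of_eq ?_) h
  rw [one_div, Real.rpow_inv_natCast_pow (norm_nonneg _) hk]

theorem eventually_cjsrAt_lt {G : Automaton V m} {A : Fin m → Matrix (Fin n) (Fin n) ℝ} {c : ℝ}
    (hc : cjsr G A < c) : ∀ᶠ k in atTop, cjsrAt G A k < c := by
  obtain ⟨K, hK⟩ := exists_cjsrAt_le G A
  refine eventually_lt_of_limsup_lt hc ?_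
  exact isBoundedUnder_of_eventually_le ((eventually_ne_atTop 0).mono hK)

theorem cjsr_nonneg (G : Automaton V m) (A : Fin m → Matrix (Fin n) (Fin n) ℝ) :
    0 ≤ cjsr G A := by
  by_contra! h
  obtain ⟨k, hk⟩ := (eventually_cjsrAt_lt h).exists
  exact hk.not_ge (cjsrAt_nonneg G A k)

end Words

/-! ### Counting paths with the adjacency matrix -/

section SpectralRadius

variable {V : Type*} [Fintype V] [DecidableEq V] {m : ℕ}

open Matrix.Norms.Operator in
/-- The number of paths of length `k` grows no faster than the `k`th power of the spectral
radius of the adjacency matrix. -/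
theorem Automaton.le_adjSpectralRadius_mul [Nonempty V] (H : Automaton V m) {x c : ℝ}
    (hx : 0 ≤ x) (hc : 0 ≤ c)
    (h : ∀ᶠ k : ℕ in atTop, x ^ k ≤ (∑ u, ∑ v, ((H.adjMatrix ^ k) u v : ℝ)) * c ^ k) :
    x ≤ H.adjSpectralRadius * c := by
  set B : Matrix V V ℂ := H.adjMatrix.map (Nat.cast : ℕ → ℂ) with hB
  have hpow : ∀ k : ℕ, B ^ k = (H.adjMatrix ^ k).map (Nat.cast : ℕ → ℂ) := fun k =>
    (Matrix.map_pow H.adjMatrix (Nat.castRingHom ℂ) k).symm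
  have hrow : ∀ k u, ∑ v, ((H.adjMatrix ^ k) u v : ℝ) ≤ ‖B ^ k‖ := by
    intro k u
    -- The chosen operator norm is the largest row sum of absolute values.
    rw [hpow, Matrix.linfty_opNorm_def]
    refine le_trans (le_of_eq ?_) (NNReal.coe_le_coe.2 (Finset.le_sup (Finset.mem_univ u)))
    simp
  -- Gelfand's formula. The factor `card V` from summing over rows disappears under `k`th roots.
  have hlim : Tendsto (fun k : ℕ => ‖B ^ k‖ ^ (1 / k : ℝ)) atTop (𝓝 H.adjSpectralRadius) := by
    have hfin : spectralRadius ℂ B ≠ ⊤ :=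
      ((spectrum.spectralRadius_le_nnnorm B).trans_lt ENNReal.coe_lt_top).ne
    refine ((ENNReal.tendsto_toReal hfin).comp
      (spectrum.pow_norm_pow_one_div_tendsto_nhds_spectralRadius B)).congr fun k => ?_
    exact ENNReal.toReal_ofReal (by positivity)
  have hcard : Tendsto (fun k : ℕ => (Fintype.card V : ℝ) ^ (1 / k : ℝ)) atTop (𝓝 1) := by
    have := (Real.continuousAt_const_rpow (a := (Fintype.card V : ℝ)) (b := 0)
      (by simp)).tendsto.comp tendsto_one_div_atTop_nhds_zero_nat
    simpa [Function.comp_def] using this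
  have hlim2 := (hcard.mul hlim).mul_const c
  rw [one_mul] at hlim2
  refine ge_of_tendsto hlim2 ?_
  filter_upwards [h, eventually_ne_atTop 0] with k hk hk0
  have h1 : x ^ k ≤ (Fintype.card V * ‖B ^ k‖) * c ^ k := by
    refine hk.trans (mul_le_mul_of_nonneg_right ?_ (by positivity))
    refine (Finset.sum_le_sum fun u _ => hrow k u).trans_eq ?_
    simp
  have h2 := Real.rpow_le_rpow (by positivity) h1 (by positivity : (0 : ℝ) ≤ (k : ℝ)⁻¹)
  rwa [Real.pow_rpow_inv_natCast hx hk0, Real.mul_rpow (by positivity) (by positivity),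
    Real.mul_rpow (by positivity) (by positivity), Real.pow_rpow_inv_natCast hc hk0,
    ← one_div] at h2

theorem Automaton.adjSpectralRadius_nonneg (H : Automaton V m) : 0 ≤ H.adjSpectralRadius :=
  ENNReal.toReal_nonneg

theorem Automaton.sum_arcs_to (H : Automaton V m) (v : V) (f : V → ℝ) :
    ∑ e ∈ H.arcs.filter (fun e => e.2.1 = v), f e.1 = ∑ u, (H.adjMatrix u v : ℝ) * f u := by
  rw [← Finset.sum_fiberwise _ (fun e : V × V × Fin m => e.1)]
  refine Finset.sum_congr rfl fun u _ => ?_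
  rw [Finset.sum_congr rfl (g := fun _ => f u) fun e he => by rw [(Finset.mem_filter.1 he).2],
    Finset.sum_const, nsmul_eq_mul, Finset.filter_filter, Automaton.adjMatrix]
  congr 3
  ext e
  simp [and_comm]

end SpectralRadius

/-! ### Growth of pseudo-measures along paths: part (1) -/

section Growth

variable {V : Type*} [Fintype V] [DecidableEq V] {m n d : ℕ}

theorem FormDual.push_apply {k : ℕ} (A : Matrix (Fin n) (Fin n) ℝ) (μ : FormDual n k)
    (p : Form n k) : μ.push A p = μ (Form.comp A p) := rfl

/-- Pseudo-measures that are expanded by the dynamics grow at most as fast as the number of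
paths times the norm of the products along them. -/
theorem pow_mul_apply_comp_normForm_le (H : Automaton V m)
    (A : Fin m → Matrix (Fin n) (Fin n) ℝ) {ν : V → FormDual n (2 * d)} {γ : ℝ} (hγ : 0 ≤ γ)
    (hν : ∀ v, (ν v).IsPseudoMeasure)
    (hgrowth : ∀ v p, p.IsSOS → γ ^ (2 * d) * ν v p ≤
      ∑ e ∈ H.arcs.filter (fun e => e.2.1 = v), ν e.1 (Form.comp (A e.2.2) p))
    {C : ℝ} (k : ℕ) (v : V) (P : Matrix (Fin n) (Fin n) ℝ)
    (hC : ∀ σ : Fin k → Fin m, H.AdmissibleTo v σ →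
      ‖Matrix.toEuclideanCLM (𝕜 := ℝ) (P * wordProduct A σ)‖ ≤ C) :
    (γ ^ (2 * d)) ^ k * ν v (Form.comp P (normForm n d)) ≤
      C ^ (2 * d) * ∑ u, ((H.adjMatrix ^ k) u v : ℝ) * ν u (normForm n d) := by
  induction k generalizing v P with
  | zero =>
    have hP : ‖Matrix.toEuclideanCLM (𝕜 := ℝ) P‖ ≤ C := by
      simpa [wordProduct] using hC Fin.elim0 ⟨fun _ => v, rfl, fun i => i.elim0⟩
    have h := hν v _ (Form.isSOS_smul_normForm_sub_comp hP d)
    simp only [map_sub, map_smul, smul_eq_mul] at h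
    simpa [Matrix.one_apply] using h
  | succ k ih =>
    have h1 : (γ ^ (2 * d)) ^ (k + 1) * ν v (Form.comp P (normForm n d)) ≤
        ∑ e ∈ H.arcs.filter (fun e => e.2.1 = v),
          (γ ^ (2 * d)) ^ k * ν e.1 (Form.comp (P * A e.2.2) (normForm n d)) := by
      have h := mul_le_mul_of_nonneg_left
        (hgrowth v _ ((Form.isSOS_normForm n d).comp P)) (by positivity : 0 ≤ (γ ^ (2 * d)) ^ k)
      rw [← mul_assoc, ← pow_succ, Finset.mul_sum] at h
      simpa only [Form.comp_comp] using h
    -- Paths are unrolled backwards from their end `v`: `P` collects the matrices already passed,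
    -- hence the induction over all `v` and `P`.
    refine h1.trans ((Finset.sum_le_sum fun e he => ih e.1 (P * A e.2.2) fun σ hσ => ?_).trans_eq ?_)
    · obtain ⟨he, hev⟩ := Finset.mem_filter.1 he
      have he' : (e.1, v, e.2.2) ∈ H.arcs := by rw [← hev]; exact he
      rw [mul_assoc, ← wordProduct_snoc]
      exact hC _ (hσ.snoc he')
    · rw [← Finset.mul_sum, H.sum_arcs_to v fun w =>
        ∑ u, ((H.adjMatrix ^ k) u w : ℝ) * ν u (normForm n d)]
      congr 1
      simp only [Finset.mul_sum, pow_succ, Matrix.mul_apply, Nat.cast_sum, Nat.cast_mul,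
        Finset.sum_mul]
      rw [Finset.sum_comm]
      refine Finset.sum_congr rfl fun u _ => Finset.sum_congr rfl fun w _ => by ring

/-- The total pseudo-measure of the arcs that leave `v`. -/
noncomputable def outMeasure (G : Automaton V m) (μ : V × V × Fin m → FormDual n (2 * d)) (v : V) :
    FormDual n (2 * d) :=
  ∑ e ∈ G.arcs.filter (fun e => e.1 = v), μ e

variable {G : Automaton V m} {A : Fin m → Matrix (Fin n) (Fin n) ℝ}
  {μ : V × V × Fin m → FormDual n (2 * d)} {γ : ℝ}

omit [Fintype V] in
theorem DualFeasible.isPseudoMeasure_outMeasure (h : DualFeasible G A d μ γ) (v : V) :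
    (outMeasure G μ v).IsPseudoMeasure := by
  intro p hp
  rw [outMeasure, LinearMap.sum_apply]
  exact Finset.sum_nonneg fun e he => h.pseudo e (Finset.mem_filter.1 he).1 p hp

theorem DualFeasible.sum_outMeasure_normForm (h : DualFeasible G A d μ γ) :
    ∑ v, outMeasure G μ v (normForm n d) = 1 := by
  rw [← h.normalized, ← Finset.sum_fiberwise _ (fun e : V × V × Fin m => e.1)]
  simp only [outMeasure, LinearMap.sum_apply]

omit [Fintype V] in
-- Incoming arcs in `Z` contribute nothing, and every other `μ e` is one of the nonnegative summands
-- of the measure leaving its source.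
theorem DualFeasible.outMeasure_growth (h : DualFeasible G A d μ γ) {Z : Finset (V × V × Fin m)}
    (hZ : ∀ e ∈ Z, μ e = 0) (v : V) (p : Form n (2 * d)) (hp : p.IsSOS) :
    γ ^ (2 * d) * outMeasure G μ v p ≤
      ∑ e ∈ (G.deleteArcs Z).arcs.filter (fun e => e.2.1 = v),
        outMeasure G μ e.1 (Form.comp (A e.2.2) p) := by
  have h1 := h.growth v p hp
  rw [LinearMap.sub_apply, LinearMap.smul_apply, LinearMap.sum_apply, sub_nonneg,
    smul_eq_mul] at h1
  refine h1.trans ?_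
  have h2 : (G.deleteArcs Z).arcs.filter (fun e => e.2.1 = v) ⊆
      G.arcs.filter (fun e => e.2.1 = v) :=
    Finset.filter_subset_filter _ Finset.sdiff_subset
  rw [← Finset.sum_subset h2]
  · refine Finset.sum_le_sum fun e he => ?_
    have heG := (Finset.mem_filter.1 (h2 he)).1
    rw [FormDual.push_apply, outMeasure, LinearMap.sum_apply]
    refine Finset.single_le_sum (f := fun e' => μ e' (Form.comp (A e.2.2) p))
      (fun e' he' => h.pseudo e' (Finset.mem_filter.1 he').1 _ (hp.comp _)) ?_
    exact Finset.mem_filter.2 ⟨heG, rfl⟩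
  · intro e he he'
    have heZ : e ∈ Z := by
      by_contra hne
      obtain ⟨h3, h4⟩ := Finset.mem_filter.1 he
      exact he' (Finset.mem_filter.2 ⟨Finset.mem_sdiff.2 ⟨h3, hne⟩, h4⟩)
    rw [FormDual.push_apply, hZ e heZ, LinearMap.zero_apply]

/-- The objective value of a dual solution that vanishes on `Z` is bounded by means of the
paths that avoid `Z`. -/
theorem DualFeasible.le_adjSpectralRadius_rpow_mul_cjsr [Nonempty V] (hd : 0 < d)
    (h : DualFeasible G A d μ γ) {Z : Finset (V × V × Fin m)} (hZ : ∀ e ∈ Z, μ e = 0) :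
    γ ≤ (G.deleteArcs Z).adjSpectralRadius ^ (1 / (2 * d : ℝ)) * cjsr G A := by
  set H := G.deleteArcs Z
  have hpaths : ∀ k : ℕ, k ≠ 0 → (γ ^ (2 * d)) ^ k ≤
      (∑ u, ∑ v, ((H.adjMatrix ^ k) u v : ℝ)) * (cjsrAt G A k ^ (2 * d)) ^ k := by
    intro k hk
    have hle : ∀ u, outMeasure G μ u (normForm n d) ≤ 1 := by
      intro u
      rw [← h.sum_outMeasure_normForm]
      exact Finset.single_le_sum (f := fun u => outMeasure G μ u (normForm n d))
        (fun u _ => h.isPseudoMeasure_outMeasure u _ (Form.isSOS_normForm n d))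
        (Finset.mem_univ u)
    have hv : ∀ v, (γ ^ (2 * d)) ^ k * outMeasure G μ v (normForm n d) ≤
        (cjsrAt G A k ^ k) ^ (2 * d) * ∑ u, ((H.adjMatrix ^ k) u v : ℝ) := by
      intro v
      have h1 := pow_mul_apply_comp_normForm_le H A h.nonneg h.isPseudoMeasure_outMeasure
        (h.outMeasure_growth hZ) k v 1 (C := cjsrAt G A k ^ k) fun σ hσ => by
          rw [one_mul]
          exact norm_wordProduct_le_cjsrAt_pow A hk (hσ.admissible Finset.sdiff_subset)
      have h2 : Form.comp (1 : Matrix (Fin n) (Fin n) ℝ) (normForm n d) = normForm n d := by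
        apply Subtype.ext
        rw [Form.coe_comp]
        simp [normForm, rowForm, Matrix.one_apply]
      rw [h2] at h1
      refine h1.trans (mul_le_mul_of_nonneg_left (Finset.sum_le_sum fun u _ => ?_) ?_)
      · exact mul_le_of_le_one_right (Nat.cast_nonneg _) (hle u)
      · have := cjsrAt_nonneg G A k
        positivity
    have hsum := Finset.sum_le_sum fun v (_ : v ∈ Finset.univ) => hv v
    rw [← Finset.mul_sum, h.sum_outMeasure_normForm, mul_one, ← Finset.mul_sum,
      Finset.sum_comm] at hsum
    rwa [pow_right_comm (cjsrAt G A k) (2 * d) k, mul_comm (∑ u, _)]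
  -- Only values strictly above the upper limit eventually bound `cjsrAt`; `c` then decreases to
  -- `cjsr G A`.
  have hlt : ∀ c, cjsr G A < c → γ ^ (2 * d) ≤ H.adjSpectralRadius * c ^ (2 * d) := by
    intro c hc
    have hc0 : 0 ≤ c := (cjsr_nonneg G A).trans hc.le
    refine H.le_adjSpectralRadius_mul (pow_nonneg h.nonneg _) (by positivity) ?_
    filter_upwards [eventually_cjsrAt_lt hc, eventually_ne_atTop 0] with k hk hk0
    refine (hpaths k hk0).trans (mul_le_mul_of_nonneg_left ?_ (by positivity))
    have := cjsrAt_nonneg G A k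
    gcongr
  have hlim : γ ^ (2 * d) ≤ H.adjSpectralRadius * cjsr G A ^ (2 * d) := by
    have hcont : Tendsto (fun c : ℝ => H.adjSpectralRadius * c ^ (2 * d)) (𝓝[>] cjsr G A)
        (𝓝 (H.adjSpectralRadius * cjsr G A ^ (2 * d))) :=
      (Continuous.tendsto (by fun_prop) _).mono_left nhdsWithin_le_nhds
    exact ge_of_tendsto hcont (eventually_mem_nhdsWithin.mono hlt)
  have hρ := H.adjSpectralRadius_nonneg
  have hc := cjsr_nonneg G A
  refine le_of_pow_le_pow_left₀ (by positivity : 2 * d ≠ 0) (by positivity) (hlim.trans_eq ?_)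
  rw [mul_pow, show (1 / (2 * d : ℝ)) = ((2 * d : ℕ) : ℝ)⁻¹ by push_cast; rw [one_div],
    Real.rpow_inv_natCast_pow hρ (by positivity)]

theorem JointlyZeroable.rhoSOS_le [Nonempty V] (hd : 0 < d) {Z : Finset (V × V × Fin m)}
    (hZ : JointlyZeroable G A d Z) :
    rhoSOS G A d ≤ (G.deleteArcs Z).adjSpectralRadius ^ (1 / (2 * d : ℝ)) * cjsr G A := by
  obtain ⟨δ, hδ, h⟩ := hZ
  refine le_of_forall_pos_le_add fun ε hε => ?_
  obtain ⟨μ, γ, hμ, hγ, hμZ⟩ := h (min ε (δ / 2)) (by positivity)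
    ((min_le_right _ _).trans_lt (half_lt_self hδ))
  have h1 := hμ.le_adjSpectralRadius_rpow_mul_cjsr hd hμZ
  have h2 := min_le_left ε (δ / 2)
  linarith

end Growth

/-! ### Pointwise values and sphere integrals -/

section Evaluation

variable {n k : ℕ}

namespace Form

theorem eval_add (p q : Form n k) (x : EuclideanSpace ℝ (Fin n)) :
    (p + q).eval x = p.eval x + q.eval x := by
  simp [Form.eval]

theorem eval_smul (c : ℝ) (p : Form n k) (x : EuclideanSpace ℝ (Fin n)) :
    (c • p).eval x = c * p.eval x := by
  simp [Form.eval]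

theorem eval_normForm (d : ℕ) (x : EuclideanSpace ℝ (Fin n)) :
    (normForm n d).eval x = ‖x‖ ^ (2 * d) := by
  rw [pow_mul, EuclideanSpace.norm_sq_eq]
  simp [Form.eval, normForm]

theorem continuous_eval (p : Form n k) : Continuous p.eval :=
  (MvPolynomial.continuous_eval _).comp (by fun_prop)

theorem IsSOS.eval_nonneg {p : Form n k} (hp : p.IsSOS) (x : EuclideanSpace ℝ (Fin n)) :
    0 ≤ p.eval x := by
  have h : ∀ q : MvPolynomial (Fin n) ℝ, IsSumSq q →
      0 ≤ MvPolynomial.eval (fun i => x i) q := by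
    intro q hq
    induction hq with
    | zero => simp
    | sq_add a _ ih => rw [map_add, map_mul]; exact add_nonneg (mul_self_nonneg _) ih
  exact h _ hp

theorem IsSOS.strictlyPositive_add_smul_normForm {d : ℕ} {p : Form n (2 * d)} (hp : p.IsSOS)
    {ε : ℝ} (hε : 0 < ε) : (p + ε • normForm n d).StrictlyPositive := by
  intro x hx
  have h := hp.eval_nonneg x
  have hx' := norm_pos_iff.2 hx
  rw [eval_add, eval_smul, eval_normForm]
  positivity

theorem sphereIntegral_smul (c : ℝ) (p : Form n k) :
    (c • p).sphereIntegral = c * p.sphereIntegral := by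
  simp only [sphereIntegral, eval_smul]
  exact integral_const_mul _ _

/-- The form is continuous and positive on the compact sphere, which is nonempty because `n > 0`. -/
theorem StrictlyPositive.sphereIntegral_pos (hn : 0 < n) {p : Form n k}
    (hp : p.StrictlyPositive) : 0 < p.sphereIntegral := by
  have : Nonempty (Fin n) := ⟨⟨0, hn⟩⟩
  have hpos : ∀ x : Metric.sphere (0 : EuclideanSpace ℝ (Fin n)) 1, 0 < p.eval x := fun x =>
    hp x (ne_zero_of_mem_unit_sphere x)
  obtain ⟨x, hx⟩ := NormedSpace.sphere_nonempty (x := (0 : EuclideanSpace ℝ (Fin n))).2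
    zero_le_one
  exact (p.continuous_eval.comp continuous_subtype_val).integral_pos_of_hasCompactSupport_nonneg_nonzero
    (HasCompactSupport.of_compactSpace _) (fun y => (hpos y).le) (x := ⟨x, hx⟩) (hpos _).ne'

end Form

end Evaluation

/-! ### Strong duality and the dual support -/

section Duality

variable {V : Type*} [Fintype V] {m n d : ℕ} {G : Automaton V m}
  {A : Fin m → Matrix (Fin n) (Fin n) ℝ} {γ : ℝ}

/-- The left-hand side of the constraint of the primal program at the arc `e`. -/
noncomputable def arcForm (A : Fin m → Matrix (Fin n) (Fin n) ℝ) (γ : ℝ)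
    (p : V → Form n (2 * d)) (e : V × V × Fin m) : Form n (2 * d) :=
  γ ^ (2 * d) • p e.1 - Form.comp (A e.2.2) (p e.2.1)

omit [Fintype V] in
theorem arcForm_add (p q : V → Form n (2 * d)) (e : V × V × Fin m) :
    arcForm A γ (p + q) e = arcForm A γ p e + arcForm A γ q e := by
  simp only [arcForm, Pi.add_apply, map_add, smul_add]
  abel

omit [Fintype V] in
theorem arcForm_smul (c : ℝ) (p : V → Form n (2 * d)) (e : V × V × Fin m) :
    arcForm A γ (c • p) e = c • arcForm A γ p e := by
  simp only [arcForm, Pi.smul_apply, map_smul, smul_sub, smul_comm c]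

/-- The normalization is not a restriction in the primal program. -/
theorem rhoSOS_le_of_strictlyPositive [Nonempty V] (hn : 0 < n) (hγ : 0 ≤ γ)
    {p : V → Form n (2 * d)} (hsos : ∀ v, (p v).IsSOS) (hpos : ∀ v, (p v).StrictlyPositive)
    (hdec : ∀ e ∈ G.arcs, (arcForm A γ p e).IsSOS) : rhoSOS G A d ≤ γ := by
  have hI : 0 < ∑ v, (p v).sphereIntegral :=
    Finset.sum_pos (fun v _ => (hpos v).sphereIntegral_pos hn) Finset.univ_nonempty
  set I := ∑ v, (p v).sphereIntegral with hIdef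
  refine csInf_le ⟨0, ?_⟩ ⟨I⁻¹ • p, hγ, fun e he => ?_, fun v => ?_, fun v x hx => ?_, ?_⟩
  · rintro γ ⟨p, hp⟩
    exact hp.nonneg
  · have h := (hdec e he).smul (inv_nonneg.2 hI.le)
    rwa [← arcForm_smul] at h
  · exact (hsos v).smul (inv_nonneg.2 hI.le)
  · rw [Pi.smul_apply, Form.eval_smul]
    exact mul_pos (inv_pos.2 hI) (hpos v x hx)
  · simp only [Pi.smul_apply, Form.sphereIntegral_smul]
    rw [← Finset.mul_sum, ← hIdef, inv_mul_cancel₀ hI.ne']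

/-- It is enough to satisfy the primal program strictly with sums of squares that need not be
strictly positive. -/
theorem rhoSOS_le_of_isSOS_arcForm_sub [Nonempty V] (hn : 0 < n) (hγ : 0 ≤ γ)
    {p : V → Form n (2 * d)} (hsos : ∀ v, (p v).IsSOS)
    (hdec : ∀ e ∈ G.arcs, (-normForm n d + arcForm A γ p e).IsSOS) : rhoSOS G A d ≤ γ := by
  have hN := Form.isSOS_normForm n d
  obtain ⟨c, hc, hcA⟩ : ∃ c : ℝ, 0 ≤ c ∧
      ∀ s, (c • normForm n d - Form.comp (A s) (normForm n d)).IsSOS := by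
    have hK : 0 ≤ ∑ s, ‖Matrix.toEuclideanCLM (𝕜 := ℝ) (A s)‖ :=
      Finset.sum_nonneg fun _ _ => norm_nonneg _
    exact ⟨_, pow_nonneg hK _, fun s => Form.isSOS_smul_normForm_sub_comp
      (Finset.single_le_sum (f := fun s => ‖Matrix.toEuclideanCLM (𝕜 := ℝ) (A s)‖)
        (fun _ _ => norm_nonneg _) (Finset.mem_univ s)) d⟩
  -- Adding `ε N` to each `p v` costs at most `ε c N` at an arc; `ε` is chosen so that the slack `N`
  -- covers this.
  obtain ⟨ε, hε, hεc⟩ : ∃ ε : ℝ, 0 < ε ∧ 0 ≤ 1 - ε * c := by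
    refine ⟨(1 + c)⁻¹, by positivity, ?_⟩
    have : (1 + c)⁻¹ * (1 + c) = 1 := inv_mul_cancel₀ (by positivity)
    have : 0 < (1 + c)⁻¹ := by positivity
    linarith
  have hsos' : ∀ v, (p v + ε • normForm n d).IsSOS := fun v => (hsos v).add (hN.smul hε.le)
  have hpos' : ∀ v, (p v + ε • normForm n d).StrictlyPositive := fun v =>
    (hsos v).strictlyPositive_add_smul_normForm hε
  refine rhoSOS_le_of_strictlyPositive hn hγ hsos' hpos' fun e he => ?_
  have h : arcForm A γ (fun v => p v + ε • normForm n d) e =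
      (-normForm n d + arcForm A γ p e) + (1 - ε * c) • normForm n d +
        ε • (c • normForm n d - Form.comp (A e.2.2) (normForm n d)) +
        (ε * γ ^ (2 * d)) • normForm n d := by
    have h1 := arcForm_add (A := A) (γ := γ) p (fun _ => ε • normForm n d) e
    have h2 : arcForm A γ (fun _ => ε • normForm n d) e = (ε * γ ^ (2 * d)) • normForm n d -
        ε • Form.comp (A e.2.2) (normForm n d) := by
      rw [arcForm, map_smul, smul_smul, mul_comm ε]
    refine h1.trans ?_
    rw [h2]
    module
  rw [h]
  exact (((hdec e he).add (hN.smul hεc)).add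
    ((hcA _).smul hε.le)).add (hN.smul (by positivity))

variable [DecidableEq V]

/-- The cone of the families of forms that become sums of squares at the arcs after the
addition of the left-hand side of the constraint of the primal program for some `p`. -/
def primalCone (G : Automaton V m) (A : Fin m → Matrix (Fin n) (Fin n) ℝ) (d : ℕ) (γ : ℝ) :
    PointedCone ℝ (V × V × Fin m → Form n (2 * d)) where
  carrier := {q | ∃ p : V → Form n (2 * d), (∀ v, (p v).IsSOS) ∧
    ∀ e ∈ G.arcs, (q e + arcForm A γ p e).IsSOS}
  add_mem' := by
    rintro q₁ q₂ ⟨p₁, hp₁, h₁⟩ ⟨p₂, hp₂, h₂⟩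
    refine ⟨p₁ + p₂, fun v => (hp₁ v).add (hp₂ v), fun e he => ?_⟩
    rw [arcForm_add, Pi.add_apply, add_add_add_comm]
    exact (h₁ e he).add (h₂ e he)
  zero_mem' := by
    refine ⟨0, fun v => Form.IsSOS.zero, fun e _ => ?_⟩
    have h : arcForm A γ (0 : V → Form n (2 * d)) e = 0 := by simp [arcForm]
    rw [h, Pi.zero_apply, add_zero]
    exact Form.IsSOS.zero
  smul_mem' := by
    rintro ⟨c, hc⟩ q ⟨p, hp, h⟩
    refine ⟨c • p, fun v => (hp v).smul hc, fun e he => ?_⟩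
    rw [arcForm_smul]
    have h2 := (h e he).smul hc
    rwa [smul_add] at h2

/-- Strong duality: there is a dual solution for every value below `ρ_SOS`. -/
theorem exists_dualFeasible_of_lt_rhoSOS [Nonempty V] (hn : 0 < n) (hγ : 0 ≤ γ)
    (hlt : γ < rhoSOS G A d) :
    ∃ μ : V × V × Fin m → FormDual n (2 * d), DualFeasible G A d μ γ := by
  set s := primalCone G A d γ
  set N : V × V × Fin m → Form n (2 * d) := fun e => if e ∈ G.arcs then normForm n d else 0
    with hNdef
  -- Membership would be a primal solution at `γ` with slack `N` on every arc, contradicting `γ <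
  -- rhoSOS G A d`.
  have hNs : -N ∉ s := by
    rintro ⟨p, hp, h⟩
    refine hlt.not_ge (rhoSOS_le_of_isSOS_arcForm_sub hn hγ hp fun e he => ?_)
    simpa [hNdef, he] using h e he
  have hN0 : N ≠ 0 := by
    intro h
    rw [h, neg_zero] at hNs
    exact hNs s.zero_mem
  -- The functional `c N ↦ c` is nonnegative on the cone since `-N` lies outside it, and it extends
  -- because large multiples of `N` dominate any family on the arcs.
  obtain ⟨g, hgN, hgs⟩ := riesz_extension s (LinearPMap.mkSpanSingleton N (1 : ℝ) hN0)
    (by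
      rintro ⟨x, hx⟩ hxs
      obtain ⟨c, rfl⟩ := Submodule.mem_span_singleton.1 hx
      have h : LinearPMap.mkSpanSingleton N (1 : ℝ) hN0 ⟨c • N, hx⟩ = c := by
        rw [LinearPMap.mkSpanSingleton'_apply]
        simp
      rw [h]
      by_contra! hc
      apply hNs
      have h2 := s.smul_mem (inv_nonneg.2 (neg_nonneg.2 hc.le)) hxs
      have h3 : (-c)⁻¹ • c • N = -N := by
        rw [smul_smul, inv_neg, neg_mul, inv_mul_cancel₀ hc.ne]
        exact neg_one_smul ℝ N
      rwa [← h3])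
    (by
      intro y
      choose t ht hty using fun e => Form.exists_isSOS_smul_normForm_add (y e)
      refine ⟨⟨(∑ e, t e) • N, Submodule.smul_mem _ _ (Submodule.mem_span_singleton_self N)⟩,
        0, fun v => Form.IsSOS.zero, fun e he => ?_⟩
      have h0 : arcForm A γ (0 : V → Form n (2 * d)) e = 0 := by simp [arcForm]
      have h1 : t e ≤ ∑ e, t e := Finset.single_le_sum (fun e _ => ht e) (Finset.mem_univ e)
      have h2 : ((∑ e, t e) • N + y) e =
          ((∑ e, t e) - t e) • normForm n d + (t e • normForm n d + y e) := by
        simp only [Pi.add_apply, Pi.smul_apply, hNdef, if_pos he]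
        module
      rw [h0, add_zero]
      change (((∑ e, t e) • N + y) e).IsSOS
      rw [h2]
      exact ((Form.isSOS_normForm n d).smul (sub_nonneg.2 h1)).add (hty e))
  have hsum : ∀ f : V × V × Fin m → Form n (2 * d),
      g (fun e => if e ∈ G.arcs then f e else 0) = ∑ e ∈ G.arcs, g (Pi.single e (f e)) := by
    intro f
    rw [← Finset.univ_sum_single (fun e => if e ∈ G.arcs then f e else 0), map_sum,
      ← Finset.sum_subset (Finset.subset_univ G.arcs)]
    · exact Finset.sum_congr rfl fun e he => by simp [he]
    · intro e _ he
      simp [he]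
  refine ⟨fun e => g.comp (LinearMap.single ℝ (fun _ => Form n (2 * d)) e), hγ, fun v p hp => ?_, fun e he p hp => ?_, ?_⟩
  -- The witness `Pi.single v p` cancels this family on the arcs; nonnegativity of `g` there is the
  -- growth condition at `v`.
  · have hP : (fun e => if e ∈ G.arcs then -arcForm A γ (Pi.single v p) e else 0) ∈ s := by
      refine ⟨Pi.single v p, fun w => ?_, fun e he => ?_⟩
      · by_cases hw : w = v
        · subst hw; simpa using hp
        · simpa [hw] using Form.IsSOS.zero
      · simpa [he] using Form.IsSOS.zero
    have h := hgs _ hP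
    rw [hsum] at h
    refine h.trans_eq ?_
    rw [LinearMap.sub_apply, LinearMap.smul_apply, LinearMap.sum_apply, LinearMap.sum_apply,
      Finset.sum_filter, Finset.sum_filter, Finset.smul_sum, ← Finset.sum_sub_distrib]
    refine Finset.sum_congr rfl fun e _ => ?_
    have h1 : ∀ q : Form n (2 * d), g (Pi.single e q) = g.comp (LinearMap.single ℝ (fun _ => Form n (2 * d)) e) q :=
      fun q => rfl
    rw [h1, arcForm, neg_sub, map_sub, map_smul]
    congr 1
    · by_cases hv : e.2.1 = v
      · rw [if_pos hv, hv, Pi.single_eq_same, FormDual.push_apply]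
      · rw [if_neg hv, Pi.single_eq_of_ne hv, map_zero, map_zero]
    · by_cases hv : e.1 = v
      · rw [if_pos hv, hv, Pi.single_eq_same]
      · rw [if_neg hv, Pi.single_eq_of_ne hv, map_zero]
  · refine hgs _ ⟨0, fun v => Form.IsSOS.zero, fun e' he' => ?_⟩
    have h0 : arcForm A γ (0 : V → Form n (2 * d)) e' = 0 := by simp [arcForm]
    rw [h0, add_zero]
    by_cases hee : e' = e
    · subst hee; simpa using hp
    · simpa [hee] using Form.IsSOS.zero
  · have h := hgN ⟨N, Submodule.mem_span_singleton_self N⟩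
    rw [LinearPMap.mkSpanSingleton_apply] at h
    rw [← h]
    exact (hsum fun _ => normForm n d).symm

theorem exists_dualFeasible_near_optimal [Nonempty V] (hn : 0 < n) (hpos : 0 < rhoSOS G A d)
    {ε : ℝ} (hε : 0 < ε) :
    ∃ (μ : V × V × Fin m → FormDual n (2 * d)) (γ : ℝ),
      DualFeasible G A d μ γ ∧ rhoSOS G A d - ε ≤ γ := by
  -- The maximum with `0` keeps `γ` nonnegative; it stays below `rhoSOS` because that value is
  -- positive.
  obtain ⟨μ, hμ⟩ := exists_dualFeasible_of_lt_rhoSOS (G := G) (A := A) (d := d)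
    (γ := max 0 (rhoSOS G A d - ε)) hn (le_max_left _ _) (max_lt hpos (by linarith))
  exact ⟨μ, _, hμ, le_max_right _ _⟩

/-- The arcs outside the dual support can simultaneously be discarded. -/
theorem jointlyZeroable_sdiff_dualSupport [Nonempty V] (hn : 0 < n)
    (hpos : 0 < rhoSOS G A d) :
    JointlyZeroable G A d (G.arcs \ (dualSupport G A d).arcs) := by
  have hzero : ∀ e ∈ G.arcs \ (dualSupport G A d).arcs, ∀ᶠ ε : ℝ in 𝓝[>] 0,
      ∀ (μ : V × V × Fin m → FormDual n (2 * d)) (γ : ℝ), DualFeasible G A d μ γ →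
        rhoSOS G A d - ε ≤ γ → μ e = 0 := by
    intro e he
    obtain ⟨heG, heD⟩ := Finset.mem_sdiff.1 he
    simp only [dualSupport, Finset.mem_filter, heG, true_and] at heD
    push Not at heD
    obtain ⟨ε, hε, -, h⟩ := heD 1 one_pos
    -- Near-optimality within a smaller `ε'` implies it within `ε`, so vanishing at one `ε` persists
    -- below it.
    filter_upwards [Ioo_mem_nhdsGT hε] with ε' hε' μ γ hμ hγ
    exact h μ γ hμ (by linarith [hε'.2])
  obtain ⟨δ, hδ, h⟩ := mem_nhdsGT_iff_exists_Ioo_subset.1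
    ((eventually_all_finset _).2 hzero)
  refine ⟨δ, hδ, fun ε hε hεδ => ?_⟩
  obtain ⟨μ, γ, hμ, hγ⟩ := exists_dualFeasible_near_optimal (A := A) (d := d) hn hpos hε
  exact ⟨μ, γ, hμ, hγ, fun e he => h ⟨hε, hεδ⟩ e he μ γ hμ hγ⟩

end Duality

theorem mainTheorem5 {V : Type*} [Fintype V] [DecidableEq V] [Nonempty V] {m n d : ℕ}
    (hn : 0 < n) (hd : 0 < d) (G : Automaton V m) (hG : G.StronglyConnected)
    (A : Fin m → Matrix (Fin n) (Fin n) ℝ) :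
    (∀ Z : Finset (V × V × Fin m), Z ⊆ G.arcs → JointlyZeroable G A d Z →
      rhoSOS G A d ≤
        (G.deleteArcs Z).adjSpectralRadius ^ (1 / (2 * d : ℝ)) * cjsr G A) ∧
    rhoSOS G A d ≤ (dualSupport G A d).adjSpectralRadius ^ (1 / (2 * d : ℝ)) * cjsr G A := by
  refine ⟨fun Z _ hZ => hZ.rhoSOS_le hd, ?_⟩
  -- At value `0` a dual solution need not exist (for instance without arcs), but the right-hand
  -- side is nonnegative.
  rcases le_or_gt (rhoSOS G A d) 0 with h | h
  · exact h.trans (mul_nonneg (Real.rpow_nonneg (Automaton.adjSpectralRadius_nonneg _) _)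
      (cjsr_nonneg G A))
  · have hsub : (dualSupport G A d).arcs ⊆ G.arcs := by
      classical exact Finset.filter_subset _ _
    have h2 := (jointlyZeroable_sdiff_dualSupport hn h).rhoSOS_le hd
    rwa [Automaton.deleteArcs, Finset.sdiff_sdiff_eq_self hsub] at h2
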